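/- **Corollary 1.5.** A *network* is a finite acyclic directed graph with edge capacities in $[0,\infty]$, finitely many messages, each available at one vertex, and a set of demanded messages at every vertex. A *code* over a finite message alphabet $A$, $|A|\ge 2$, assigns to every edge $e$ a finite alphabet $B_e$, an encoding function that computes the symbol on $e$ from the symbols on the edges entering the tail of $e$ and the messages available there, and to every vertex a decoding function that recovers the messages demanded there from the entering symbols and the messages available there, for all values of the messages. It achieves the rate $R\ge 0$ if $R\log_2|B_e|\le c(e)\log_2|A|$ for every edge $e$ of capacity $c(e)$. The *coding capacity* is the supremum of the rates achieved by codes. A code is *linear* over a finite field $F$ if every message is one letter of $F$, every edge $e$ carries a vector of $\ell(e)$ letters of $F$, and all encoding and decoding functions are $F$-linear. Linear codes over finite fields $F_1,\dots,F_r$ ($r\ge 1$, the fields may differ), used side by side on messages $(x^{(1)},\dots,x^{(r)})$ with $x^{(s)}\in F_s$, where the $s$-th code has lengths $\ell_s(e)$, achieve the rate $R$ if $R\sum_s \ell_s(e)\log_2|F_s|\le c(e)\sum_s\log_2|F_s|$ for every edge $e$. The *linear coding capacity* is the supremum of the rates achieved in this way. Let $N$ be the following network. It has sources $s_1,\dots,s_{23}$,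 sinks $t_1,\dots,t_{23}$ and two further vertices $u,w$; the message $x_i$ is available at $s_i$ and demanded at $t_i$. The edges $(s_i,u)$ and $(w,t_i)$ for all $i$, and $(s_j,t_i)$ for all $i,j$ that are adjacent in the complement $\overline{C}_{23}$ of the cycle on $23$ vertices, have infinite capacity; the edge $(u,w)$ has capacity $1$; there are no other edges. Then $N$ has $48$ vertices, its linear coding capacity is exactly $1/3$, its coding capacity is finite and at least $1/\log_2 4.809$, and the ratio of its coding capacity to its linear coding capacity is at least $1.324$. -/

import Mathlib

open scoped NNReal ENNReal

/-! ### Networks and network codes -/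

/-- A network: a finite acyclic directed graph with edge capacities in `[0, ∞]` (capacity `0` means
that there is no edge), with finitely many messages, each of them available at one vertex, and with
a set of demanded messages at every vertex. -/
structure Network where
  V : Type
  M : Type
  finV : Finite V
  finM : Finite M
  cap : V → V → ℝ≥0∞
  source : M → V
  demand : V → Set M
  acyclic : ∀ v, ¬ Relation.TransGen (fun a b => cap a b ≠ 0) v v

/-- A code for the network `N` with message alphabet `A`, in which the edge from `u` to `v` carries
a symbol of the alphabet `B u v`: a local encoding function for every edge `(u, v)` and a decoding
function for every vertex. Each of them sees the symbols on the edges that enter the vertex and the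
messages that are available at it. -/
structure Network.Code (N : Network) (A : Type) (B : N.V → N.V → Type) where
  enc : ∀ u v : N.V, (∀ w, B w u) → ({m : N.M // N.source m = u} → A) → B u v
  dec : ∀ v : N.V, (∀ w, B w v) → ({m : N.M // N.source m = v} → A) →
    ({m : N.M // m ∈ N.demand v} → A)

/-- When the messages are `x`, the symbols `y u v` on the edges are those that the local encoding
functions produce. -/
def Network.Code.Produces {N : Network} {A : Type} {B : N.V → N.V → Type} (C : N.Code A B)
    (x : N.M → A) (y : ∀ u v, B u v) : Prop :=
  ∀ u v, y u v = C.enc u v (fun w => y w u) (fun m => x m.1)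

/-- The code is correct: whatever the messages are, every vertex decodes all messages that it
demands. -/
def Network.Code.Correct {N : Network} {A : Type} {B : N.V → N.V → Type} (C : N.Code A B) : Prop :=
  ∀ x : N.M → A, ∃ y : ∀ u v, B u v, C.Produces x y ∧
    ∀ (v : N.V) (m : {m : N.M // m ∈ N.demand v}),
      C.dec v (fun w => y w v) (fun m' => x m'.1) m = x m.1

/-- Linearity over a field `K` of a code in which every message is one letter of `K` and the edge
from `u` to `v` carries `ℓ u v` letters of `K`: all encoding and decoding functions are linear. -/
def Network.Code.IsLinear {N : Network} {K : Type} [Field K] {ℓ : N.V → N.V → ℕ}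
    (C : N.Code K (fun u v => Fin (ℓ u v) → K)) : Prop :=
  (∀ u v : N.V, IsLinearMap K
    (fun p : (∀ w : N.V, Fin (ℓ w u) → K) × ({m : N.M // N.source m = u} → K) =>
      C.enc u v p.1 p.2)) ∧
  (∀ v : N.V, IsLinearMap K
    (fun p : (∀ w : N.V, Fin (ℓ w v) → K) × ({m : N.M // N.source m = v} → K) =>
      C.dec v p.1 p.2))

/-- The size in bits, `log₂ |X|`, of a symbol of the (finite) alphabet `X`. -/
noncomputable def bits (X : Type) : ℝ≥0∞ := ENNReal.ofReal (Real.logb 2 (Nat.card X))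

/-- The rate `R` is achieved by some block code: there is a correct code over finite alphabets such
that, if every message consists of `R` bits per unit of time (so that the code runs for
`bits A / R` units of time), then no edge carries more bits per unit of time than its capacity. -/
def Network.Achieves (N : Network) (R : ℝ≥0) : Prop :=
  ∃ (A : Type) (_ : Finite A) (_ : Nontrivial A)
    (B : N.V → N.V → Type) (_ : ∀ u v, Finite (B u v)) (C : N.Code A B),
    C.Correct ∧ ∀ u v, (R : ℝ≥0∞) * bits (B u v) ≤ N.cap u v * bits A

/-- The rate `R` is achieved by linear codes. A message is a sequence of `r ≥ 1` letters, the
`s`-th letter being an element of a finite field `K s`; the fields may differ. For every `s` the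
`s`-th letters of all messages are transmitted by a linear code over `K s`, in which the edge from
`u` to `v` carries `ℓ s u v` letters of `K s`. The case `r = 1` is that of a single linear code
over a single finite field. -/
def Network.LinearlyAchieves (N : Network) (R : ℝ≥0) : Prop :=
  ∃ (r : ℕ) (_ : 0 < r) (K : Fin r → Type) (_ : ∀ s, Field (K s)) (_ : ∀ s, Finite (K s))
    (ℓ : Fin r → N.V → N.V → ℕ)
    (C : ∀ s, N.Code (K s) (fun u v => Fin (ℓ s u v) → K s)),
    (∀ s, (C s).Correct ∧ (C s).IsLinear) ∧
    ∀ u v, (R : ℝ≥0∞) * ∑ s, (ℓ s u v : ℝ≥0∞) * bits (K s) ≤ N.cap u v * ∑ s, bits (K s)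

/-- The coding capacity: the supremum of the rates that are achieved by block codes. -/
noncomputable def Network.codingCapacity (N : Network) : ℝ≥0∞ :=
  ⨆ (R : ℝ≥0) (_ : N.Achieves R), (R : ℝ≥0∞)

/-- The linear coding capacity: the supremum of the rates that are achieved by linear codes. -/
noncomputable def Network.linearCodingCapacity (N : Network) : ℝ≥0∞ :=
  ⨆ (R : ℝ≥0) (_ : N.LinearlyAchieves R), (R : ℝ≥0∞)

/-! ### Broadcast instances and their networks -/

/-- A broadcast instance (a directed hypergraph) with `n` blocks and `m` receivers: receiver `j`
wants the block `want j` and knows the blocks in `side j`. -/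
structure BroadcastInstance (n m : ℕ) where
  want : Fin m → Fin n
  side : Fin m → Set (Fin n)

/-- The index coding instance of a graph: receiver `i` wants block `i` and knows the blocks of the
neighbours of `i`. -/
def SimpleGraph.broadcastInstance {n : ℕ} (G : SimpleGraph (Fin n)) : BroadcastInstance n n where
  want := id
  side i := G.neighborSet i

/-- The vertices of the network of a broadcast instance: a source `src i` for every block, a sink
`sink j` for every receiver, and two special vertices `u` and `w`. -/
inductive BroadcastVertex (n m : ℕ) : Type
  | src (i : Fin n)
  | sink (j : Fin m)
  | u
  | w

namespace BroadcastVertex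

variable {n m : ℕ}

/-- Position of a vertex in a topological order. -/
def level : BroadcastVertex n m → ℕ
  | src _ => 0
  | u => 1
  | w => 2
  | sink _ => 3

/-- The vertices as a sum type. -/
def toSum : BroadcastVertex n m → (Fin n ⊕ Fin m) ⊕ Bool
  | src i => Sum.inl (Sum.inl i)
  | sink j => Sum.inl (Sum.inr j)
  | u => Sum.inr true
  | w => Sum.inr false

theorem toSum_injective : Function.Injective (toSum (n := n) (m := m)) := by
  intro a b h
  cases a <;> cases b <;> simp_all [toSum]

open Classical in
/-- Capacities: infinite from every source to `u`, from `w` to every sink, and from the source of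
a block to every sink whose receiver knows that block; `1` from `u` to `w`. -/
noncomputable def capacity (H : BroadcastInstance n m) :
    BroadcastVertex n m → BroadcastVertex n m → ℝ≥0∞
  | src _, u => ⊤
  | u, w => 1
  | w, sink _ => ⊤
  | src i, sink j => if i ∈ H.side j then ⊤ else 0
  | _, _ => 0

theorem level_lt_of_capacity_ne_zero (H : BroadcastInstance n m) (a b : BroadcastVertex n m)
    (h : capacity H a b ≠ 0) : level a < level b := by
  cases a <;> cases b <;> simp_all [capacity, level]

/-- The blocks that are demanded at a vertex. -/
def demand (H : BroadcastInstance n m) : BroadcastVertex n m → Set (Fin n)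
  | sink j => {H.want j}
  | _ => ∅

end BroadcastVertex

/-- The network of a broadcast instance. -/
noncomputable def BroadcastInstance.network {n m : ℕ} (H : BroadcastInstance n m) : Network where
  V := BroadcastVertex n m
  M := Fin n
  finV := Finite.of_injective _ BroadcastVertex.toSum_injective
  finM := inferInstance
  cap := BroadcastVertex.capacity H
  source := BroadcastVertex.src
  demand := BroadcastVertex.demand H
  acyclic := by
    have key : ∀ a b, Relation.TransGen
        (fun a b => BroadcastVertex.capacity H a b ≠ 0) a b →
        BroadcastVertex.level a < BroadcastVertex.level b := by
      intro a b h
      induction h with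
      | single h => exact BroadcastVertex.level_lt_of_capacity_ne_zero H _ _ h
      | tail _ h ih => exact ih.trans (BroadcastVertex.level_lt_of_capacity_ne_zero H _ _ h)
    exact fun v h => lt_irrefl _ (key v v h)

/-- The network of the index coding instance of the complement of the cycle on `23` vertices. -/
noncomputable def antiholeNetwork : Network :=
  (SimpleGraph.broadcastInstance (SimpleGraph.cycleGraph 23)ᶜ).network

/-! ### Vector linear codes for broadcast networks -/

namespace BroadcastInstance

variable {n m : ℕ}

open BroadcastVertex

/-! On this network both capacities are governed by colourings of the cycle `C₂₃`, whose independent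
sets are the cliques of the complement. A clique serves all its members with one broadcast letter,
the sum of their letters: each member knows every other summand.

Linear capacity: `C₂₃` has a proper 3-colouring, giving rate 1/3. Conversely, let `v i` be the
broadcast vector of the `i`-th unit message. Decodability keeps `v i` out of the span of `v (i - 1)`
and `v (i + 1)`; in dimension at most 2 this makes `v i` and `v (i + 2)` parallel, and oddness makes
all vectors parallel, a contradiction (`three_le_finrank_of_odd_cycle`). The bound 3 holds over
every field, so mixing fields does not help.

Coding capacity: blocks of 11 bits allow fractional colourings. The 23 rotations of an independent
11-set cover each vertex 11 times, giving rate 11/23. This exceeds both required bounds, since 2^23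
≤ 4.809^11 and 33/23 ≥ 1.324. Finiteness follows from the unit bottleneck. -/

open Classical in
/-- Edge lengths: messages have `a` letters, the broadcast edge carries `L` letters, edges of
capacity `0` carry nothing. -/
noncomputable def len (H : BroadcastInstance n m) (a L : ℕ) :
    BroadcastVertex n m → BroadcastVertex n m → ℕ
  | src _, u => a
  | u, w => L
  | w, sink _ => L
  | src i, sink j => if i ∈ H.side j then a else 0
  | _, _ => 0

end BroadcastInstance

/-- Extension of a tuple by zeros, or its truncation. -/
def resize {K : Type} [Zero K] {k : ℕ} (a : ℕ) (y : Fin k → K) : Fin a → K :=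
  fun s => if h : s.1 < k then y ⟨s.1, h⟩ else 0

theorem resize_self {K : Type} [Zero K] {k : ℕ} (y : Fin k → K) : resize k y = y := by
  ext s; simp [resize]

theorem resize_resize {K : Type} [Zero K] {a k : ℕ} (y : Fin a → K) (h : k = a) :
    resize a (resize k y) = y := by
  subst h; simp [resize_self]

theorem resize_add {K : Type} [AddMonoid K] {k : ℕ} (a : ℕ) (y z : Fin k → K) :
    resize a (y + z) = resize a y + resize a z := by
  ext s; simp only [resize, Pi.add_apply]; split_ifs <;> simp

theorem resize_smul {K : Type} [Field K] {k : ℕ} (a : ℕ) (c : K) (y : Fin k → K) :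
    resize a (c • y) = c • resize a y := by
  ext s; simp only [resize, Pi.smul_apply]; split_ifs <;> simp

namespace BroadcastInstance

variable {n m : ℕ}

open BroadcastVertex

/-- The network code of a linear index code with encoding map `φ` and decoding maps `ψ j`. -/
noncomputable def vectorCode (H : BroadcastInstance n m) {K A : Type} [Field K] [AddCommGroup A]
    [Module K A] {a L : ℕ} (e : A ≃ₗ[K] (Fin a → K)) (φ : (Fin n → A) →ₗ[K] (Fin L → K))
    (ψ : Fin m → (Fin L → K) × (Fin n → A) →ₗ[K] A) :
    H.network.Code A (fun p q => Fin (H.len a L p q) → K) where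
  enc p q := match p, q with
    | src i, q => fun _ x => resize (H.len a L (src i) q) (e (x ⟨i, rfl⟩))
    | u, w => fun y _ => φ (fun i => e.symm (resize a (y (src i))))
    | w, sink _ => fun y _ => y u
    | _, _ => fun _ _ => 0
  dec v := match v with
    | sink j => fun y _ _ => ψ j (y w, fun i => e.symm (resize a (y (src i))))
    | _ => fun _ _ _ => 0

/-- A sink sees zeros in place of unknown blocks, so `ψ j` has to work for every `x'` that agrees
with `x` on the side information. -/
theorem vectorCode_correct (H : BroadcastInstance n m) {K A : Type} [Field K] [AddCommGroup A]
    [Module K A] {a L : ℕ} (e : A ≃ₗ[K] (Fin a → K)) (φ : (Fin n → A) →ₗ[K] (Fin L → K))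
    (ψ : Fin m → (Fin L → K) × (Fin n → A) →ₗ[K] A)
    (h : ∀ j x x', (∀ i ∈ H.side j, x' i = x i) → ψ j (φ x, x') = x (H.want j)) :
    (H.vectorCode e φ ψ).Correct := by
  intro x
  refine ⟨fun p q => match p, q with
    | src i, q => resize (H.len a L (src i) q) (e (x i))
    | u, w => φ x
    | w, sink _ => φ x
    | _, _ => 0, ?_, ?_⟩
  · have hx : (fun i => e.symm (resize a (resize (H.len a L (src i) u) (e (x i))))) = x := by
      funext i
      rw [resize_resize _ (by rfl)]
      simp
    intro p q
    rcases p with i | j | _ | _ <;> rcases q with i' | j' | _ | _ <;> try rfl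
    exact (congrArg φ hx).symm
  · rintro (i | j | _ | _) ⟨k, hk⟩
    · exact hk.elim
    · obtain rfl : k = H.want j := hk
      refine h j x _ fun i hi => ?_
      have hl : H.len a L (src i) (sink j) = a := by simp [len, hi]
      change e.symm (resize a (resize (H.len a L (src i) (sink j)) (e (x i)))) = x i
      rw [resize_resize _ hl]
      simp
    · exact hk.elim
    · exact hk.elim

theorem vectorCode_isLinear (H : BroadcastInstance n m) {K : Type} [Field K] {a L : ℕ}
    (e : K ≃ₗ[K] (Fin a → K)) (φ : (Fin n → K) →ₗ[K] (Fin L → K))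
    (ψ : Fin m → (Fin L → K) × (Fin n → K) →ₗ[K] K) :
    (H.vectorCode e φ ψ).IsLinear := by
  constructor
  · rintro (i | j | _ | _) q
    · constructor
      · intro p p'
        change resize _ (e (p.2 _ + p'.2 _)) = resize _ (e (p.2 _)) + resize _ (e (p'.2 _))
        rw [map_add, resize_add]
      · intro c p
        change resize _ (e (c • p.2 _)) = c • resize _ (e (p.2 _))
        rw [map_smul, resize_smul]
    · rcases q with i' | j' | _ | _ <;> exact (0 : _ →ₗ[K] _).isLinear
    · rcases q with i' | j' | _ | _
      · exact (0 : _ →ₗ[K] _).isLinear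
      · exact (0 : _ →ₗ[K] _).isLinear
      · exact (0 : _ →ₗ[K] _).isLinear
      · constructor
        · intro p p'
          change φ (fun i => e.symm (resize a (p.1 (src i) + p'.1 (src i)))) = φ _ + φ _
          rw [← map_add]
          congr 1
          funext i
          rw [resize_add, map_add]
          rfl
        · intro c p
          change φ (fun i => e.symm (resize a (c • p.1 (src i)))) = c • φ _
          rw [← map_smul]
          congr 1
          funext i
          rw [resize_smul, map_smul]
          rfl
    · rcases q with i' | j' | _ | _
      · exact (0 : _ →ₗ[K] _).isLinear
      · exact ⟨fun _ _ => rfl, fun _ _ => rfl⟩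
      · exact (0 : _ →ₗ[K] _).isLinear
      · exact (0 : _ →ₗ[K] _).isLinear
  · rintro (i | j | _ | _)
    · exact (0 : _ →ₗ[K] _).isLinear
    · constructor
      · intro p p'
        funext _
        change ψ j (p.1 w + p'.1 w, fun i => e.symm (resize a (p.1 (src i) + p'.1 (src i)))) =
          ψ j _ + ψ j _
        rw [← map_add]
        congr 1
        refine Prod.ext rfl ?_
        funext i
        dsimp only
        rw [resize_add, map_add]
        rfl
      · intro c p
        funext _
        change ψ j (c • p.1 w, fun i => e.symm (resize a (c • p.1 (src i)))) = c • ψ j _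
        rw [← map_smul]
        congr 1
        refine Prod.ext rfl ?_
        funext i
        dsimp only
        rw [resize_smul, map_smul]
        rfl
    · exact (0 : _ →ₗ[K] _).isLinear
    · exact (0 : _ →ₗ[K] _).isLinear

theorem mul_len_le_capacity (H : BroadcastInstance n m) {a L : ℕ} (ha : 0 < a) {R : ℝ≥0}
    (hR : R * L ≤ a) {b : ℝ≥0∞} (hb : b ≠ 0) (p q : BroadcastVertex n m) :
    (R : ℝ≥0∞) * (H.len a L p q * b) ≤ capacity H p q * (a * b) := by
  have hab : (a : ℝ≥0∞) * b ≠ 0 := mul_ne_zero (by exact_mod_cast ha.ne') hb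
  have hR' : (R : ℝ≥0∞) * L ≤ a := by exact_mod_cast hR
  rcases p with i | j | _ | _ <;> rcases q with i' | j' | _ | _ <;>
    simp only [len, capacity, Nat.cast_zero, zero_mul, mul_zero, le_refl, ENNReal.top_mul hab,
      le_top, one_mul]
  · split_ifs
    · simp [ENNReal.top_mul hab]
    · simp
  · rw [← mul_assoc]
    gcongr

end BroadcastInstance

/-! ### Fractional clique covers -/

theorem SimpleGraph.exists_linear_index_code {n : ℕ} (G : SimpleGraph (Fin n)) {K A : Type}
    [Field K] [AddCommGroup A] [Module K A] {a L : ℕ} (e : A ≃ₗ[K] (Fin a → K))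
    (κ : Fin n → Fin a → Fin L) (hinj : ∀ i, Function.Injective (κ i))
    (hclique : ∀ i j s t, i ≠ j → κ i s = κ j t → G.Adj i j) :
    ∃ (φ : (Fin n → A) →ₗ[K] (Fin L → K)) (ψ : Fin n → (Fin L → K) × (Fin n → A) →ₗ[K] A),
      ∀ i x x', (∀ j ∈ G.broadcastInstance.side i, x' j = x j) →
        ψ i (φ x, x') = x (G.broadcastInstance.want i) := by
  classical
  let letter (j : Fin n) (t : Fin a) : (Fin n → A) →ₗ[K] K :=
    LinearMap.proj t ∘ₗ e.toLinearMap ∘ₗ LinearMap.proj j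
  let part (c : Fin L) (j : Fin n) : (Fin n → A) →ₗ[K] K :=
    ∑ t, if κ j t = c then letter j t else 0
  -- Broadcast letter `c` is the sum over clique `c`. Receiver `i` finds its letter `s` by
  -- subtracting the other members' letters from broadcast letter `κ i s`.
  refine ⟨LinearMap.pi fun c => ∑ j, part c j, fun i => e.symm.toLinearMap ∘ₗ LinearMap.pi fun s =>
    LinearMap.proj (R := K) (φ := fun _ => K) (κ i s) ∘ₗ LinearMap.fst K _ _ -
      (∑ j ∈ Finset.univ.erase i, part (κ i s) j) ∘ₗ LinearMap.snd K _ _, ?_⟩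
  intro i x x' hx
  change e.symm _ = x i
  rw [LinearEquiv.symm_apply_eq]
  funext s
  have hother : ∀ j ∈ Finset.univ.erase i, part (κ i s) j x' = part (κ i s) j x := by
    intro j hj
    simp only [part, LinearMap.sum_apply]
    refine Finset.sum_congr rfl fun t _ => ?_
    split_ifs with h
    · have hadj := hclique i j s t (Finset.ne_of_mem_erase hj).symm h.symm
      simp [letter, hx j hadj]
    · rfl
  -- Injectivity of `κ i` ensures that block `i` puts only its letter `s` into this clique.
  have hself : part (κ i s) i x = e (x i) s := by
    simp only [part, LinearMap.sum_apply]
    rw [Finset.sum_eq_single s]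
    · simp [letter]
    · intro t _ hts
      rw [if_neg fun h => hts (hinj i h)]
      rfl
    · simp
  simp only [LinearMap.pi_apply, LinearMap.sub_apply, LinearMap.comp_apply, LinearMap.proj_apply,
    LinearMap.fst_apply, LinearMap.snd_apply, LinearMap.sum_apply]
  rw [Finset.sum_congr rfl hother, ← Finset.add_sum_erase _ _ (Finset.mem_univ i), hself]
  simp

theorem bits_pi (K : Type) [Finite K] (k : ℕ) : bits (Fin k → K) = k * bits K := by
  rw [bits, bits, ← ENNReal.ofReal_natCast, ← ENNReal.ofReal_mul (by positivity)]
  simp [Nat.card_fun, Real.logb_pow]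

theorem bits_pos (K : Type) [Finite K] [Nontrivial K] : 0 < bits K := by
  rw [bits, ENNReal.ofReal_pos]
  exact Real.logb_pos (by norm_num) (by exact_mod_cast Finite.one_lt_card)

theorem bits_ne_top (K : Type) : bits K ≠ ⊤ := ENNReal.ofReal_ne_top

/-- A fractional clique cover by `L` cliques that covers every vertex `a` times gives a block code
of rate `a / L`. -/
theorem SimpleGraph.achieves_of_fractional_clique_cover {n : ℕ} (G : SimpleGraph (Fin n))
    {a L : ℕ} (ha : 0 < a) (κ : Fin n → Fin a → Fin L) (hinj : ∀ i, Function.Injective (κ i))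
    (hclique : ∀ i j s t, i ≠ j → κ i s = κ j t → G.Adj i j) {R : ℝ≥0} (hR : R * L ≤ a) :
    G.broadcastInstance.network.Achieves R := by
  obtain ⟨φ, ψ, h⟩ := G.exists_linear_index_code (LinearEquiv.refl (ZMod 2) (Fin a → ZMod 2))
    κ hinj hclique
  have : Nonempty (Fin a) := ⟨⟨0, ha⟩⟩
  -- Messages are `a` bits long, so for `a > 1` this is not a linear code in the one-letter sense.
  refine ⟨Fin a → ZMod 2, inferInstance, inferInstance, _, fun _ _ => inferInstance,
    _, BroadcastInstance.vectorCode_correct _ (.refl _ _) φ ψ h, fun p q => ?_⟩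
  rw [bits_pi, bits_pi]
  exact BroadcastInstance.mul_len_le_capacity _ ha hR (bits_pos _).ne' p q

/-- A clique cover by `L` cliques gives a linear code of rate `1 / L`. -/
theorem SimpleGraph.linearlyAchieves_of_clique_cover {n : ℕ} (G : SimpleGraph (Fin n))
    {L : ℕ} (κ : Fin n → Fin L) (hclique : ∀ i j, i ≠ j → κ i = κ j → G.Adj i j) {R : ℝ≥0}
    (hR : R * L ≤ 1) :
    G.broadcastInstance.network.LinearlyAchieves R := by
  let e := (LinearEquiv.funUnique (Fin 1) (ZMod 2) (ZMod 2)).symm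
  obtain ⟨φ, ψ, h⟩ := G.exists_linear_index_code e (fun i _ => κ i)
    (fun _ => Function.injective_of_subsingleton _) (fun i j _ _ => hclique i j)
  refine ⟨1, one_pos, fun _ => ZMod 2, fun _ => inferInstance, fun _ => inferInstance,
    fun _ => G.broadcastInstance.len 1 L, fun _ => BroadcastInstance.vectorCode _ e φ ψ,
    fun _ => ⟨BroadcastInstance.vectorCode_correct _ e φ ψ h,
      BroadcastInstance.vectorCode_isLinear _ e φ ψ⟩, fun p q => ?_⟩
  have := BroadcastInstance.mul_len_le_capacity G.broadcastInstance one_pos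
    (by simpa using hR) (bits_pos (ZMod 2)).ne' p q
  change _ ≤ BroadcastVertex.capacity _ p q * _
  simpa using this

/-! ### Upper bounds -/

namespace BroadcastInstance

variable {n m : ℕ}

open BroadcastVertex

/-- In a correct code whose edges of capacity `0` carry nothing, the broadcast symbol is a function
of the messages, namely the following one. -/
def broadcastSymbol (H : BroadcastInstance n m) {A : Type}
    {B : BroadcastVertex n m → BroadcastVertex n m → Type} (C : H.network.Code A B)
    (y₀ : ∀ p q, B p q) (x : Fin n → A) : B u w :=
  C.enc u w (fun p => match p with
      | src i => C.enc (src i) u (fun p => y₀ p (src i)) (fun m' => x m'.1)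
      | sink j => y₀ (sink j) u
      | u => y₀ u u
      | w => y₀ w u)
    (fun m' => x m'.1)

/-- Edges entering a source have capacity 0, so their symbols are forced and `y₀` is only a
placeholder. -/
theorem broadcastSymbol_eq (H : BroadcastInstance n m) {A : Type}
    {B : BroadcastVertex n m → BroadcastVertex n m → Type} {C : H.network.Code A B}
    (hB : ∀ p q, capacity H p q = 0 → Subsingleton (B p q)) (y₀ : ∀ p q, B p q)
    {x : Fin n → A} {y : ∀ p q, B p q} (hy : C.Produces x y) :
    y u w = H.broadcastSymbol C y₀ x := by
  rw [hy u w, broadcastSymbol]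
  congr 1
  funext p
  have hsub (p q) (h : capacity H p q = 0) (b b' : B p q) : b = b' := (hB p q h).elim b b'
  rcases p with i | j | _ | _
  · dsimp only
    rw [hy (src i) u]
    congr 1
    funext p
    exact hsub _ _ (by cases p <;> rfl) _ _
  all_goals exact hsub _ _ rfl _ _

/-- A receiver recovers its block from the broadcast symbol and its side information. -/
theorem eq_of_broadcastSymbol_eq (H : BroadcastInstance n m) {A : Type}
    {B : BroadcastVertex n m → BroadcastVertex n m → Type} {C : H.network.Code A B}
    (hC : C.Correct) (hB : ∀ p q, capacity H p q = 0 → Subsingleton (B p q))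
    (y₀ : ∀ p q, B p q) {x x' : Fin n → A} (j : Fin m)
    (h : H.broadcastSymbol C y₀ x = H.broadcastSymbol C y₀ x')
    (hside : ∀ i ∈ H.side j, x i = x' i) : x (H.want j) = x' (H.want j) := by
  have hsub (p q) (h : capacity H p q = 0) (b b' : B p q) : b = b' := (hB p q h).elim b b'
  obtain ⟨y, hy, hd⟩ := hC x
  obtain ⟨y', hy', hd'⟩ := hC x'
  rw [← hd (sink j) ⟨H.want j, rfl⟩, ← hd' (sink j) ⟨H.want j, rfl⟩]
  have hy_eq : (fun p => y p (sink j)) = fun p => y' p (sink j) := by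
    funext p
    rcases p with i | k | _ | _
    · by_cases hi : i ∈ H.side j
      · refine (hy (src i) (sink j)).trans (Eq.trans ?_ (hy' (src i) (sink j)).symm)
        congr 1
        · funext p
          exact hsub _ _ (by cases p <;> rfl) _ _
        · funext ⟨k, hk⟩
          obtain rfl : k = i := BroadcastVertex.src.inj hk
          exact hside k hi
      · exact hsub _ _ (by simp [capacity, hi]) _ _
    · exact hsub _ _ rfl _ _
    · exact hsub _ _ rfl _ _
    · refine (hy w (sink j)).trans (Eq.trans ?_ (hy' w (sink j)).symm)
      congr 1
      · funext p
        rcases p with i | k | _ | _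
        · exact hsub _ _ rfl _ _
        · exact hsub _ _ rfl _ _
        · exact (H.broadcastSymbol_eq hB y₀ hy).trans
            (h.trans (H.broadcastSymbol_eq hB y₀ hy').symm)
        · exact hsub _ _ rfl _ _
      · funext ⟨k, hk⟩
        exact BroadcastVertex.noConfusion rfl rfl (heq_of_eq hk)
  have hm_eq : (fun m' : {k : Fin n // src k = (sink j : BroadcastVertex n m)} => x m'.1) =
      fun m' => x' m'.1 := by
    funext ⟨k, hk⟩
    exact BroadcastVertex.noConfusion rfl rfl (heq_of_eq hk)
  exact congrFun (congrArg₂ (C.dec (sink j)) hy_eq hm_eq) ⟨H.want j, rfl⟩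

/-- If a receiver does not know the block it wants, the coding capacity is at most `1`. -/
theorem codingCapacity_le_one (H : BroadcastInstance n m) (j : Fin m) (hj : H.want j ∉ H.side j) :
    H.network.codingCapacity ≤ 1 := by
  refine iSup₂_le fun R hR => ?_
  rcases eq_or_ne R 0 with rfl | hR0
  · simp
  obtain ⟨A, _, _, B, hfin, C, hC, hcap⟩ := hR
  have hfin (p q : BroadcastVertex n m) : Finite (B p q) := hfin p q
  obtain ⟨a⟩ : Nonempty A := inferInstance
  obtain ⟨y₀, -⟩ := hC fun _ => a
  -- At a positive rate, a zero-capacity edge has a symbol of zero bits.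
  have hB : ∀ p q, capacity H p q = 0 → Subsingleton (B p q) := by
    intro p q h0
    by_contra hn
    rw [not_subsingleton_iff_nontrivial] at hn
    have h := hcap p q
    rw [show H.network.cap p q = 0 from h0, zero_mul, nonpos_iff_eq_zero, mul_eq_zero] at h
    exact h.elim (by exact_mod_cast hR0) (bits_pos (B p q)).ne'
  -- With all other blocks frozen, the side information is constant, so the broadcast symbol alone
  -- must determine the wanted block.
  have hinj : Function.Injective fun b : A =>
      H.broadcastSymbol C y₀ (Function.update (fun _ => a) (H.want j) b) := by
    intro b b' h
    have := H.eq_of_broadcastSymbol_eq hC hB y₀ j h fun i hi => by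
      have hne : i ≠ H.want j := fun h => hj (h ▸ hi)
      simp [hne]
    simpa using this
  have hcard : Nat.card A ≤ Nat.card (B u w) := Nat.card_le_card_of_injective _ hinj
  have hbits : bits A ≤ bits (B u w) := by
    refine ENNReal.ofReal_le_ofReal (Real.logb_le_logb_of_le (by norm_num) ?_ ?_)
    · exact_mod_cast Nat.card_pos
    · exact_mod_cast hcard
  have h : (R : ℝ≥0∞) * bits A ≤ 1 * bits A :=
    (mul_le_mul_right hbits _).trans (hcap u w)
  exact (ENNReal.mul_le_mul_iff_left (bits_pos A).ne' (bits_ne_top A)).1 h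

/-- The encoding map of a linear code whose edges of capacity `0` carry nothing. -/
theorem exists_linearMap_of_isLinear (H : BroadcastInstance n m) {K : Type} [Field K]
    {ℓ : BroadcastVertex n m → BroadcastVertex n m → ℕ}
    {C : H.network.Code K (fun p q => Fin (ℓ p q) → K)} (hC : C.Correct) (hlin : C.IsLinear)
    (hℓ : ∀ p q, capacity H p q = 0 → ℓ p q = 0) :
    ∃ φ : (Fin n → K) →ₗ[K] (Fin (ℓ u w) → K),
      ∀ j x, φ x = 0 → (∀ i ∈ H.side j, x i = 0) → x (H.want j) = 0 := by
  have hB : ∀ p q, capacity H p q = 0 → Subsingleton (Fin (ℓ p q) → K) := by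
    intro p q h
    rw [hℓ p q h]
    infer_instance
  let encL (p q : BroadcastVertex n m) := (hlin.1 p q).mk'
  let inL : (Fin n → K) →ₗ[K] (∀ p, Fin (ℓ p u) → K) := LinearMap.pi fun p => match p with
    | src i => encL (src i) u ∘ₗ
        LinearMap.prod 0 (LinearMap.pi fun m' => LinearMap.proj m'.1)
    | sink _ => 0
    | u => 0
    | w => 0
  let φ : (Fin n → K) →ₗ[K] (Fin (ℓ u w) → K) :=
    encL u w ∘ₗ LinearMap.prod inL (LinearMap.pi fun m' => LinearMap.proj m'.1)
  have hφ : ∀ x, φ x = H.broadcastSymbol C (fun _ _ => 0) x := by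
    intro x
    change C.enc u w (inL x) _ = C.enc u w _ _
    congr 1
    funext p
    rcases p with i | j | _ | _ <;> rfl
  refine ⟨φ, fun j x hx hside => ?_⟩
  refine H.eq_of_broadcastSymbol_eq hC hB (fun _ _ => 0) (x' := 0) j ?_ hside
  rw [← hφ, ← hφ, hx, map_zero]

end BroadcastInstance

/-- The vectors of a linear index code for the complement of an odd cycle span at least three
dimensions. -/
theorem three_le_finrank_of_odd_cycle {K W : Type*} [Field K] [AddCommGroup W] [Module K W]
    [FiniteDimensional K W] {N : ℕ} (hN : Odd N) (v : ZMod N → W)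
    (hv : ∀ i, v i ∉ Submodule.span K {v (i - 1), v (i + 1)}) : 3 ≤ Module.finrank K W := by
  by_contra! hlt
  have hv0 : ∀ i, v i ≠ 0 := fun i h => hv i (h ▸ Submodule.zero_mem _)
  -- The span omits `v i`, so it is proper in dimension at most 2; containing a nonzero vector, it
  -- is the line of either generator.
  have hline : ∀ i j, Submodule.span K {v (i - 1), v (i + 1)} = Submodule.span K {v j} ∨
      (j ≠ i - 1 ∧ j ≠ i + 1) := by
    intro i j
    by_cases hj : j = i - 1 ∨ j = i + 1
    · left
      symm
      refine Submodule.eq_of_le_of_finrank_le (Submodule.span_mono ?_) ?_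
      · rcases hj with rfl | rfl <;> simp
      · rw [finrank_span_singleton (hv0 j)]
        have : Module.finrank K (Submodule.span K {v (i - 1), v (i + 1)}) <
            Module.finrank K W :=
          Submodule.finrank_lt fun h => hv i (h ▸ Submodule.mem_top)
        omega
    · exact Or.inr (not_or.1 hj)
  have hstep : ∀ i, Submodule.span K {v (i + 2)} = Submodule.span K {v i} := by
    intro i
    have h1 := (hline (i + 1) (i + 2)).resolve_right fun h => h.2 (by ring)
    have h2 := (hline (i + 1) i).resolve_right fun h => h.1 (by ring)
    rw [← h1, h2]
  have heven : ∀ k : ℕ, Submodule.span K {v (2 * k)} = Submodule.span K {v 0} := by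
    intro k
    induction k with
    | zero => simp
    | succ k ih => rw [← ih, ← hstep (2 * k)]; congr 3; push_cast; ring
  obtain ⟨k, hk⟩ := hN
  have hk0 : ((2 * k + 1 : ℕ) : ZMod N) = 0 := by rw [← hk]; exact ZMod.natCast_self N
  -- For `N = 2k + 1`, steps of length 2 reach 1 from 0, as `2 (k + 1) = 1` modulo `N`.
  have h1 : Submodule.span K {v 1} = Submodule.span K {v 0} := by
    rw [← heven (k + 1)]
    congr 3
    push_cast at hk0 ⊢
    linear_combination -hk0
  apply hv 1
  have hmem : v 1 ∈ Submodule.span K {v 0} := h1 ▸ Submodule.mem_span_singleton_self _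
  refine Submodule.span_mono ?_ hmem
  simp

/-! ### The complement of the cycle on `23` vertices -/

theorem three_le_length_of_antihole {K : Type} [Field K]
    {ℓ : BroadcastVertex 23 23 → BroadcastVertex 23 23 → ℕ}
    {C : antiholeNetwork.Code K (fun p q => Fin (ℓ p q) → K)} (hC : C.Correct) (hlin : C.IsLinear)
    (hℓ : ∀ p q, antiholeNetwork.cap p q = 0 → ℓ p q = 0) :
    3 ≤ ℓ BroadcastVertex.u BroadcastVertex.w := by
  obtain ⟨φ, hφ⟩ := BroadcastInstance.exists_linearMap_of_isLinear _ hC hlin hℓ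
  let v : Fin 23 → (Fin (ℓ BroadcastVertex.u BroadcastVertex.w) → K) := fun i => φ (Pi.single i 1)
  have := three_le_finrank_of_odd_cycle (K := K) (N := 23) (by decide) v fun (i : Fin 23) hi => by
    obtain ⟨c, d, hcd⟩ := Submodule.mem_span_pair.1 hi
    have hne : i - 1 ≠ i ∧ i + 1 ≠ i := by clear hcd hi; revert i; decide
    -- A dependence gives a message broadcast as 0 and vanishing on all that receiver `i` knows, yet
    -- with `i`-th block 1.
    have h0 : φ (Pi.single i 1 - c • Pi.single (i - 1) 1 - d • Pi.single (i + 1) 1) = 0 := by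
      simp only [map_sub, map_smul]
      rw [sub_sub, sub_eq_zero]
      exact hcd.symm
    have h1 := hφ i _ h0 fun j hj => by
      have hadj : (SimpleGraph.cycleGraph 23)ᶜ.Adj i j := hj
      rw [SimpleGraph.compl_adj, SimpleGraph.cycleGraph_adj] at hadj
      obtain ⟨hij, hn⟩ := hadj
      have hj1 : j ≠ i - 1 := fun h => hn (Or.inl (by rw [h]; abel))
      have hj2 : j ≠ i + 1 := fun h => hn (Or.inr (by rw [h]; abel))
      simp [hij.symm, hj1, hj2]
    simp [SimpleGraph.broadcastInstance, hne.1.symm, hne.2.symm] at h1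
  simpa using this

theorem antihole_linearCodingCapacity_le : antiholeNetwork.linearCodingCapacity ≤ 1 / 3 := by
  refine iSup₂_le fun R hR => ?_
  rcases eq_or_ne R 0 with rfl | hR0
  · simp
  obtain ⟨r, hr, K, hK, hfin, ℓ, C, hC, hcap⟩ := hR
  have hlen : ∀ s, 3 ≤ ℓ s BroadcastVertex.u BroadcastVertex.w := by
    intro s
    refine three_le_length_of_antihole (hC s).1 (hC s).2 fun p q h0 => ?_
    have h := hcap p q
    rw [h0, zero_mul, nonpos_iff_eq_zero, mul_eq_zero] at h
    have h := h.resolve_left (by exact_mod_cast hR0)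
    rw [Finset.sum_eq_zero_iff] at h
    have h := (mul_eq_zero.1 (h s (Finset.mem_univ s))).resolve_right (bits_pos (K s)).ne'
    exact_mod_cast h
  set S : ℝ≥0∞ := ∑ s, bits (K s) with hS
  have hS0 : S ≠ 0 := fun h =>
    (bits_pos (K ⟨0, hr⟩)).ne' (Finset.sum_eq_zero_iff.1 h ⟨0, hr⟩ (Finset.mem_univ _))
  have hStop : S ≠ ⊤ := ENNReal.sum_ne_top.2 fun s _ => bits_ne_top _
  have hle : (R : ℝ≥0∞) * (3 * S) ≤ 1 * S := by
    refine (mul_le_mul_right ?_ _).trans (hcap BroadcastVertex.u BroadcastVertex.w)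
    rw [hS, Finset.mul_sum]
    refine Finset.sum_le_sum fun s _ => ?_
    gcongr
    exact_mod_cast hlen s
  rw [← mul_assoc] at hle
  rw [ENNReal.le_div_iff_mul_le (by simp) (by simp)]
  exact (ENNReal.mul_le_mul_iff_left hS0 hStop).1 hle

theorem antihole_le_linearCodingCapacity : 1 / 3 ≤ antiholeNetwork.linearCodingCapacity := by
  have h : antiholeNetwork.LinearlyAchieves (1 / 3) := by
    refine SimpleGraph.linearlyAchieves_of_clique_cover _ (L := 3)
      -- Colour the path 0, …, 21 by parity and give 22 a third colour.
      (fun i => if i = 22 then 2 else if i.1 % 2 = 0 then 0 else 1) ?_ (by norm_num)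
    simp only [SimpleGraph.compl_adj, SimpleGraph.cycleGraph_adj]
    decide +kernel
  refine le_trans (le_of_eq ?_) (le_iSup₂_of_le (1 / 3) h le_rfl)
  rw [ENNReal.coe_div (by norm_num)]
  simp

theorem antihole_le_codingCapacity : 11 / 23 ≤ antiholeNetwork.codingCapacity := by
  have h : antiholeNetwork.Achieves (11 / 23) := by
    refine SimpleGraph.achieves_of_fractional_clique_cover _ (a := 11) (L := 23) (by norm_num)
      -- Class `c` is `{c, c - 2, …, c - 20}` modulo 23. Its differences are even integers of
      -- absolute value at most 20, hence never ±1 modulo 23.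
      (fun i s => i + 2 * s.castLE (by norm_num)) (fun i s t h => ?_) (fun i j s t hij h => ?_)
      (by push_cast; rw [div_mul_cancel₀]; norm_num)
    · have h : (2 : Fin 23) * s.castLE (by norm_num) = 2 * t.castLE (by norm_num) :=
        add_left_cancel h
      clear * - h
      revert s t
      decide
    · rw [SimpleGraph.compl_adj, SimpleGraph.cycleGraph_adj]
      have key : ∀ s t : Fin 11, (1 : Fin 23) + 2 * s.castLE (by norm_num) ≠
          2 * t.castLE (by norm_num) := by decide
      refine ⟨hij, ?_⟩
      rintro (h1 | h1)
      · refine key s t ?_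
        rw [sub_eq_iff_eq_add] at h1
        rw [h1, add_right_comm, add_comm] at h
        exact add_left_cancel h
      · refine key t s ?_
        rw [sub_eq_iff_eq_add] at h1
        rw [h1, add_right_comm, add_comm _ i] at h
        exact (add_left_cancel h).symm
  refine le_trans (le_of_eq ?_) (le_iSup₂_of_le (11 / 23) h le_rfl)
  rw [ENNReal.coe_div (by norm_num)]
  simp

/-! ### Vertex count and numerical conclusion -/

theorem BroadcastVertex.card (n m : ℕ) : Nat.card (BroadcastVertex n m) = n + m + 2 := by
  have hs : Function.Surjective (BroadcastVertex.toSum (n := n) (m := m)) := by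
    rintro ((i | j) | _ | _)
    exacts [⟨.src i, rfl⟩, ⟨.sink j, rfl⟩, ⟨.w, rfl⟩, ⟨.u, rfl⟩]
  rw [Nat.card_eq_of_bijective _ ⟨BroadcastVertex.toSum_injective, hs⟩]
  simp

theorem corollary1p5 :
    Nat.card antiholeNetwork.V = 48 ∧
    antiholeNetwork.linearCodingCapacity = 1 / 3 ∧
    ENNReal.ofReal (1 / Real.logb 2 4.809) ≤ antiholeNetwork.codingCapacity ∧
    antiholeNetwork.codingCapacity ≠ ⊤ ∧
    (1.324 : ℝ) ≤
      antiholeNetwork.codingCapacity.toReal / antiholeNetwork.linearCodingCapacity.toReal := by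
  have hlin : antiholeNetwork.linearCodingCapacity = 1 / 3 :=
    le_antisymm antihole_linearCodingCapacity_le antihole_le_linearCodingCapacity
  have htop : antiholeNetwork.codingCapacity ≠ ⊤ :=
    ne_top_of_le_ne_top ENNReal.one_ne_top
      (BroadcastInstance.codingCapacity_le_one _ 0 (SimpleGraph.irrefl (SimpleGraph.cycleGraph 23)ᶜ (v := 0)))
  have hlow : (11 / 23 : ℝ) ≤ antiholeNetwork.codingCapacity.toReal := by
    simpa using ENNReal.toReal_mono htop antihole_le_codingCapacity
  refine ⟨BroadcastVertex.card 23 23, hlin, ?_, htop, ?_⟩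
  · refine ENNReal.ofReal_le_of_le_toReal (le_trans ?_ hlow)
    -- Equivalent to 2^23 ≤ 4.809^11 after taking logarithms.
    have hlog : (23 / 11 : ℝ) ≤ Real.logb 2 4.809 := by
      have h : Real.logb 2 ((2 : ℝ) ^ 23) ≤ Real.logb 2 ((4.809 : ℝ) ^ 11) :=
        Real.logb_le_logb_of_le (by norm_num) (by norm_num) (by norm_num)
      rw [Real.logb_pow, Real.logb_pow, Real.logb_self_eq_one (by norm_num)] at h
      push_cast at h
      linarith
    rw [div_le_div_iff₀ (by linarith) (by norm_num)]
    linarith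
  · rw [hlin]
    simp only [one_div, ENNReal.toReal_inv, ENNReal.toReal_ofNat, div_inv_eq_mul]
    linarith
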